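/- \textbf{Setting.} All quantum systems are finite-dimensional. A \emph{state} is a positive semidefinite operator of trace one; a \emph{channel} (mechanism) is a linear, completely positive, trace-preserving map. A framework $(\mathcal S,\mathcal Q,\Theta)$ on a system with Hilbert space $\mathcal H$ consists of a collection $\mathcal S$ of sets of states on $\mathcal H$ (secrets), a symmetric set $\mathcal Q\subseteq\mathcal S\times\mathcal S$ of pairs of disjoint secrets, and a set $\Theta$ of finitely supported probability distributions $P_X$ on an index set $\mathcal X$ of an ensemble of states $\{\rho^x\}_{x\in\mathcal X}$ on $\mathcal H$. For a set $\mathcal R$ of states put $$P_X(\mathcal R)=\sum_{x:\rho^x\in\mathcal R}P_X(x),\qquad \rho^{\mathcal R}=\sum_{x:\rho^x\in\mathcal R}\frac{P_X(x)}{P_X(\mathcal R)}\,\rho^x\quad\text{if }P_X(\mathcal R)>0 .$$ A mechanism $\mathcal A$ is $(\varepsilon,\delta)$-QPP in $(\mathcal S,\mathcal Q,\Theta,\bar{\mathcal M})$, where $\bar{\mathcal M}$ is the set of all measurement operators on the output system, if for all $P_X\in\Theta$, all $(\mathcal R,\mathcal T)\in\mathcal Q$ with $P_X(\mathcal R),P_X(\mathcal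 T)>0$ and all operators $0\le M\le I$, $$\operatorname{Tr}[M\mathcal A(\rho^{\mathcal R})]\le e^{\varepsilon}\operatorname{Tr}[M\mathcal A(\rho^{\mathcal T})]+\delta .$$ The composed mechanism $\mathcal A_1\otimes\mathcal A_2$ acts on inputs $\rho^{X_1}\otimes\rho^{X_2}$ with $X_1,X_2$ independent and both distributed according to the same $P_X\in\Theta$. It is $(\varepsilon,\delta)$-QPP in the composed framework $(\mathcal S,\mathcal Q^{(2)},\Theta,\bar{\mathcal M}^2)$ if for all $P_X\in\Theta$, all $(\mathcal R_1,\mathcal T_1),(\mathcal R_2,\mathcal T_2)\in\mathcal Q$ with $P_X(\mathcal R_i),P_X(\mathcal T_i)>0$ for $i\in\{1,2\}$, and all joint measurement operators $0\le M\le I$ on the two output systems, $$\operatorname{Tr}[M(\mathcal A_1\otimes\mathcal A_2)(\rho^{\mathcal R_1}\otimes\rho^{\mathcal R_2})]\le e^{\varepsilon}\operatorname{Tr}[M(\mathcal A_1\otimes\mathcal A_2)(\rho^{\mathcal T_1}\otimes\rho^{\mathcal T_2})]+\delta .$$ \textbf{Theorem (Properties of QPP with $\mathcal M=\bar{\mathcal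 M}$).} Let $\varepsilon,\varepsilon_1,\varepsilon_2\ge 0$ and $\delta,\delta_1,\delta_2\in[0,1]$. \begin{enumerate} \item \emph{Convexity.} Let $\mathcal A_1,\dots,\mathcal A_k$ be mechanisms with the same input and output systems that are $(\varepsilon,\delta)$-QPP in $(\mathcal S,\mathcal Q,\Theta,\bar{\mathcal M})$, and let $(p_1,\dots,p_k)$ be a probability vector. Then the mechanism that applies $\mathcal A_i$ with probability $p_i$, i.e. $\sum_{i=1}^k p_i\mathcal A_i$, is $(\varepsilon,\delta)$-QPP in $(\mathcal S,\mathcal Q,\Theta,\bar{\mathcal M})$. \item \emph{Post-processing.} If $\mathcal A$ is $(\varepsilon,\delta)$-QPP in $(\mathcal S,\mathcal Q,\Theta,\bar{\mathcal M})$ and $\mathcal N$ is a quantum channel on the output system of $\mathcal A$, then $\mathcal N\circ\mathcal A$ is $(\varepsilon,\delta)$-QPP in $(\mathcal S,\mathcal Q,\Theta,\bar{\mathcal M})$. \item \emph{Parallel composability.} If $\mathcal A_i$ is $(\varepsilon_i,\delta_i)$-QPP in $(\mathcal S,\mathcal Q,\Theta,\bar{\mathcal M})$ for $i\in\{1,2\}$,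 then in the composed framework $(\mathcal S,\mathcal Q^{(2)},\Theta,\bar{\mathcal M}^2)$: \begin{enumerate} \item if $\delta_1,\delta_2<1$, then $\mathcal A_1\otimes\mathcal A_2$ is $(\varepsilon',\delta')$-QPP with $$\varepsilon'=\varepsilon_1+\varepsilon_2+\ln\!\left(\frac{1}{(1-\delta_1)(1-\delta_2)}\right),\qquad \delta'=\sqrt{\delta_1(2-\delta_1)}+\sqrt{\delta_2(2-\delta_2)};$$ \item $\mathcal A_1\otimes\mathcal A_2$ is $\bigl(\varepsilon_1+\varepsilon_2,\ \min\{\delta_1+e^{\varepsilon_1}\delta_2,\ \delta_2+e^{\varepsilon_2}\delta_1\}\bigr)$-QPP; \item in particular, if $\delta_1=\delta_2=0$, then $\mathcal A_1\otimes\mathcal A_2$ is $(\varepsilon_1+\varepsilon_2,0)$-QPP. \end{enumerate} \end{enumerate} When a resulting second parameter exceeds $1$, "$(\varepsilon,\delta)$-QPP" means that the displayed inequality holds with that $\delta$. -/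

import Mathlib

open scoped Kronecker ComplexOrder

noncomputable section

namespace QPP

/-! Finite-dimensional systems are described by finite index types `a`, `b`, ...: the Hilbert space
is `ℂ^a`, operators on it are complex `a × a` matrices, and the tensor product of the systems `a`
and `b` has index type `a × b`, the tensor product of operators being `⊗ₖ`. -/

/-- Density operators (quantum states): positive semidefinite operators of trace one. -/
def DensityOp (a : Type*) [Fintype a] : Type _ :=
  {ρ : Matrix a a ℂ // ρ.PosSemidef ∧ ρ.trace = 1}

/-- The operator underlying a state. -/
def DensityOp.mat {a : Type*} [Fintype a] (ρ : DensityOp a) : Matrix a a ℂ := ρ.1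

/-- The product state `ρ ⊗ σ`. -/
def DensityOp.tensor {a b : Type*} [Fintype a] [Fintype b] (ρ : DensityOp a) (σ : DensityOp b) :
    DensityOp (a × b) :=
  ⟨ρ.mat ⊗ₖ σ.mat, ρ.2.1.kronecker σ.2.1, by
    rw [Matrix.trace_kronecker, DensityOp.mat, DensityOp.mat, ρ.2.2, σ.2.2, one_mul]⟩

/-- A product state determines its factors. -/
theorem DensityOp.tensor_inj {a b : Type*} [Fintype a] [Fintype b] {ρ ρ' : DensityOp a}
    {σ σ' : DensityOp b} (h : ρ.tensor σ = ρ'.tensor σ') : ρ = ρ' ∧ σ = σ' := by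
  have h0 : ∀ i j k l, ρ.1 i j * σ.1 k l = ρ'.1 i j * σ'.1 k l := fun i j k l =>
    congrFun (congrFun (congrArg Subtype.val h) (i, k)) (j, l)
  have t1 : ∑ i, ρ.1 i i = 1 := ρ.2.2
  have t1' : ∑ i, ρ'.1 i i = 1 := ρ'.2.2
  have t2 : ∑ i, σ.1 i i = 1 := σ.2.2
  have t2' : ∑ i, σ'.1 i i = 1 := σ'.2.2
  constructor
  · apply Subtype.ext
    ext i j
    have : ∑ k, ρ.1 i j * σ.1 k k = ∑ k, ρ'.1 i j * σ'.1 k k :=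
      Finset.sum_congr rfl fun k _ => h0 i j k k
    rwa [← Finset.mul_sum, ← Finset.mul_sum, t2, t2', mul_one, mul_one] at this
  · apply Subtype.ext
    ext k l
    have : ∑ i, ρ.1 i i * σ.1 k l = ∑ i, ρ'.1 i i * σ'.1 k l :=
      Finset.sum_congr rfl fun i _ => h0 i i k l
    rwa [← Finset.sum_mul, ← Finset.sum_mul, t1, t1', one_mul, one_mul] at this

/-! ### Quantum channels -/

/-- The operator `(id_r ⊗ Φ)(Y)`, for an operator `Y` on the tensor product of a reference system
`r` and the input system `a` of `Φ`: the map `Φ` is applied to every `a × a` block of `Y`. -/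
def ampliation (r : Type*) {a b : Type*} (Φ : Matrix a a ℂ →ₗ[ℂ] Matrix b b ℂ)
    (Y : Matrix (r × a) (r × a) ℂ) : Matrix (r × b) (r × b) ℂ :=
  Matrix.of fun u v => Φ (Matrix.of fun p q => Y (u.1, p) (v.1, q)) u.2 v.2

/-- Complete positivity: `id_n ⊗ Φ` maps positive semidefinite operators to positive semidefinite
operators, for every dimension `n` of the reference system. -/
def CompletelyPositive {a b : Type*} (Φ : Matrix a a ℂ →ₗ[ℂ] Matrix b b ℂ) : Prop :=
  ∀ (n : ℕ) (Y : Matrix (Fin n × a) (Fin n × a) ℂ), Y.PosSemidef →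
    (ampliation (Fin n) Φ Y).PosSemidef

/-- In the definition of complete positivity, every finite reference system is allowed. -/
theorem CompletelyPositive.ampliation {a b : Type*} {Φ : Matrix a a ℂ →ₗ[ℂ] Matrix b b ℂ}
    (h : CompletelyPositive Φ) (r : Type*) [Fintype r] {Y : Matrix (r × a) (r × a) ℂ}
    (hY : Y.PosSemidef) : (QPP.ampliation r Φ Y).PosSemidef := by
  have e := Fintype.equivFin r
  have h1 := h (Fintype.card r) _ (hY.submatrix (Prod.map e.symm id))
  have h2 := h1.submatrix (Prod.map e id)
  convert h2 using 1
  ext u v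
  simp [QPP.ampliation, Matrix.submatrix]

/-- A quantum channel (quantum algorithm, mechanism) from the system `a` to the system `b`: a linear,
completely positive and trace-preserving map. -/
structure Channel (a b : Type*) [Fintype a] [Fintype b] where
  /-- the underlying linear map -/
  toLin : Matrix a a ℂ →ₗ[ℂ] Matrix b b ℂ
  completelyPositive : CompletelyPositive toLin
  trace_preserving : ∀ Y, (toLin Y).trace = Y.trace

/-- The channel `N ∘ A`. -/
def Channel.comp {a b c : Type*} [Fintype a] [Fintype b] [Fintype c]
    (N : Channel b c) (A : Channel a b) : Channel a c where
  toLin := N.toLin ∘ₗ A.toLin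
  completelyPositive n Y hY := N.completelyPositive n _ (A.completelyPositive n Y hY)
  trace_preserving Y := by
    rw [LinearMap.comp_apply, N.trace_preserving, A.trace_preserving]

/-- The mechanism `A_I` that applies `A i` with probability `p i`, that is, the channel
`ρ ↦ ∑ i, p i • A i ρ`. -/
def Channel.mix {a b : Type*} [Fintype a] [Fintype b] {k : ℕ} (p : Fin k → ℝ)
    (hp : p ∈ stdSimplex ℝ (Fin k)) (A : Fin k → Channel a b) : Channel a b where
  toLin := ∑ i, (p i : ℂ) • (A i).toLin
  completelyPositive n Y hY := by
    have h : ampliation (Fin n) (∑ i, (p i : ℂ) • (A i).toLin) Y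
        = ∑ i, (p i : ℂ) • ampliation (Fin n) (A i).toLin Y := by
      ext u v
      simp [ampliation, Matrix.sum_apply]
    rw [h]
    exact Matrix.posSemidef_sum _ fun i _ =>
      ((A i).completelyPositive n Y hY).smul (by exact_mod_cast hp.1 i)
  trace_preserving Y := by
    have h1 : ∑ i, (p i : ℂ) = 1 := by exact_mod_cast congrArg (fun x : ℝ => (x : ℂ)) hp.2
    simp [LinearMap.sum_apply, Matrix.trace_sum, (A _).trace_preserving, ← Finset.sum_mul, h1]

/-- The linear map `Φ ⊗ Ψ` on operators of a composite system: `Ψ` acts on the blocks belonging to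
the second factor and `Φ` on the first factor. -/
def tensorLin {a₁ a₂ b₁ b₂ : Type*} (Φ : Matrix a₁ a₁ ℂ →ₗ[ℂ] Matrix b₁ b₁ ℂ)
    (Ψ : Matrix a₂ a₂ ℂ →ₗ[ℂ] Matrix b₂ b₂ ℂ) :
    Matrix (a₁ × a₂) (a₁ × a₂) ℂ →ₗ[ℂ] Matrix (b₁ × b₂) (b₁ × b₂) ℂ where
  toFun Y := Matrix.of fun u v =>
    Φ (Matrix.of fun i j => Ψ (Matrix.of fun p q => Y (i, p) (j, q)) u.2 v.2) u.1 v.1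
  map_add' Y Z := by
    ext u v
    have h1 : ∀ i j, (Matrix.of fun p q => (Y + Z) (i, p) (j, q))
        = (Matrix.of fun p q => Y (i, p) (j, q)) + Matrix.of fun p q => Z (i, p) (j, q) :=
      fun i j => rfl
    have h2 : (Matrix.of fun i j => Ψ (Matrix.of fun p q => (Y + Z) (i, p) (j, q)) u.2 v.2)
        = (Matrix.of fun i j => Ψ (Matrix.of fun p q => Y (i, p) (j, q)) u.2 v.2)
          + Matrix.of fun i j => Ψ (Matrix.of fun p q => Z (i, p) (j, q)) u.2 v.2 := by
      ext i j
      change Ψ _ u.2 v.2 = Ψ _ u.2 v.2 + Ψ _ u.2 v.2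
      rw [h1, map_add, Matrix.add_apply]
    change Φ _ u.1 v.1 = Φ _ u.1 v.1 + Φ _ u.1 v.1
    rw [h2, map_add, Matrix.add_apply]
  map_smul' c Y := by
    ext u v
    have h1 : ∀ i j, (Matrix.of fun p q => (c • Y) (i, p) (j, q))
        = c • (Matrix.of fun p q => Y (i, p) (j, q)) := fun i j => rfl
    have h2 : (Matrix.of fun i j => Ψ (Matrix.of fun p q => (c • Y) (i, p) (j, q)) u.2 v.2)
        = c • (Matrix.of fun i j => Ψ (Matrix.of fun p q => Y (i, p) (j, q)) u.2 v.2) := by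
      ext i j
      change Ψ _ u.2 v.2 = c * Ψ _ u.2 v.2
      rw [h1, map_smul, Matrix.smul_apply, smul_eq_mul]
    change Φ _ u.1 v.1 = c * Φ _ u.1 v.1
    rw [h2, map_smul, Matrix.smul_apply, smul_eq_mul]

/-- `Φ ⊗ Ψ` is the linear map with `(Φ ⊗ Ψ)(Y ⊗ Z) = Φ(Y) ⊗ Ψ(Z)`. -/
theorem tensorLin_kronecker {a₁ a₂ b₁ b₂ : Type*} (Φ : Matrix a₁ a₁ ℂ →ₗ[ℂ] Matrix b₁ b₁ ℂ)
    (Ψ : Matrix a₂ a₂ ℂ →ₗ[ℂ] Matrix b₂ b₂ ℂ) (Y : Matrix a₁ a₁ ℂ) (Z : Matrix a₂ a₂ ℂ) :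
    tensorLin Φ Ψ (Y ⊗ₖ Z) = Φ Y ⊗ₖ Ψ Z := by
  ext u v
  have h1 : ∀ i j, (Matrix.of fun p q => (Y ⊗ₖ Z) (i, p) (j, q)) = Y i j • Z := fun i j => rfl
  have h2 : (Matrix.of fun i j => Ψ (Matrix.of fun p q => (Y ⊗ₖ Z) (i, p) (j, q)) u.2 v.2)
      = Ψ Z u.2 v.2 • Y := by
    ext i j
    change Ψ _ u.2 v.2 = Ψ Z u.2 v.2 * Y i j
    rw [h1, map_smul, Matrix.smul_apply, smul_eq_mul, mul_comm]
  change Φ (Matrix.of fun i j => Ψ (Matrix.of fun p q => (Y ⊗ₖ Z) (i, p) (j, q)) u.2 v.2) u.1 v.1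
    = Φ Y u.1 v.1 * Ψ Z u.2 v.2
  rw [h2]
  simp [mul_comm]

/-- The parallel composition `A ⊗ B` of two channels. -/
def Channel.tensor {a₁ a₂ b₁ b₂ : Type*} [Fintype a₁] [Fintype a₂] [Fintype b₁] [Fintype b₂]
    (A : Channel a₁ b₁) (B : Channel a₂ b₂) : Channel (a₁ × a₂) (b₁ × b₂) where
  toLin := tensorLin A.toLin B.toLin
  completelyPositive n Y hY := by
    let Y1 : Matrix ((Fin n × a₁) × a₂) ((Fin n × a₁) × a₂) ℂ :=
      Y.submatrix (fun x => (x.1.1, (x.1.2, x.2))) (fun x => (x.1.1, (x.1.2, x.2)))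
    have h1 : Y1.PosSemidef := hY.submatrix _
    have h2 := (B.completelyPositive.ampliation (Fin n × a₁) h1).submatrix
      (fun x : (Fin n × b₂) × a₁ => ((x.1.1, x.2), x.1.2))
    have h3 := (A.completelyPositive.ampliation (Fin n × b₂) h2).submatrix
      (fun x : Fin n × (b₁ × b₂) => ((x.1, x.2.2), x.2.1))
    exact h3
  trace_preserving Y := by
    have hA : ∀ k, ∑ i, (A.toLin (Matrix.of fun i j =>
        B.toLin (Matrix.of fun p q => Y (i, p) (j, q)) k k)) i i
        = ∑ i, B.toLin (Matrix.of fun p q => Y (i, p) (i, q)) k k :=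
      fun k => A.trace_preserving _
    have hB : ∀ i, ∑ k, B.toLin (Matrix.of fun p q => Y (i, p) (i, q)) k k
        = ∑ k, Y (i, k) (i, k) := fun i => B.trace_preserving _
    change ∑ u : b₁ × b₂, (A.toLin (Matrix.of fun i j =>
        B.toLin (Matrix.of fun p q => Y (i, p) (j, q)) u.2 u.2)) u.1 u.1 = ∑ u : a₁ × a₂, Y u u
    rw [Fintype.sum_prod_type_right, Fintype.sum_prod_type]
    simp only [hA]
    rw [Finset.sum_comm]
    simp only [hB]

/-! ### Data distributions and pufferfish frameworks -/

/-- Finitely supported probability distributions on the set `X` of data indices. -/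
structure DataDist (X : Type*) where
  /-- the probabilities of the points of `X` -/
  weight : X →₀ ℝ
  nonneg : ∀ x, 0 ≤ weight x
  sum_eq_one : ∑ x ∈ weight.support, weight x = 1

open Classical in
/-- `P_X(R) = ∑_{x : ρ^x ∈ R} P_X(x)`, the probability that `ρ^X` belongs to `R`. -/
def DataDist.prob {X a : Type*} [Fintype a] (P : DataDist X) (ρ : X → DensityOp a)
    (R : Set (DensityOp a)) : ℝ :=
  ∑ x ∈ P.weight.support with ρ x ∈ R, P.weight x

open Classical in
/-- The operator `ρ^R = ∑_{x : ρ^x ∈ R} (P_X(x) / P_X(R)) ρ^x`, the expected state conditioned on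
the event that `ρ^X` belongs to `R`. It is only used when `P_X(R) > 0`. -/
def DataDist.condState {X a : Type*} [Fintype a] (P : DataDist X) (ρ : X → DensityOp a)
    (R : Set (DensityOp a)) : Matrix a a ℂ :=
  ∑ x ∈ P.weight.support with ρ x ∈ R, ((P.weight x / P.prob ρ R : ℝ) : ℂ) • (ρ x).mat

/-- The law of a pair of independent data points, both with law `P`. -/
def DataDist.square {X : Type*} (P : DataDist X) : DataDist (X × X) where
  weight := Finsupp.onFinset (P.weight.support ×ˢ P.weight.support)
    (fun x => P.weight x.1 * P.weight x.2) (by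
      intro x hx
      rw [Finset.mem_product, Finsupp.mem_support_iff, Finsupp.mem_support_iff]
      exact ⟨left_ne_zero_of_mul hx, right_ne_zero_of_mul hx⟩)
  nonneg x := mul_nonneg (P.nonneg _) (P.nonneg _)
  sum_eq_one := by
    rw [Finset.sum_subset Finsupp.support_onFinset_subset
      (fun x _ hx => by rwa [Finsupp.mem_support_iff, not_not] at hx)]
    simp only [Finsupp.onFinset_apply]
    rw [Finset.sum_product]
    simp [← Finset.mul_sum, P.sum_eq_one]

/-- The components `(𝒮, 𝒬, Θ)` of a quantum pufferfish framework on the system `a`, together with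
the ensemble `{ρ^x}` indexed by `X`. The remaining component, the set of measurements, lives on the
output system of a mechanism and is a separate argument below. The index set `X` may be infinite, but
every data distribution is finitely supported; this covers finite ensembles as well as (for
`X = DensityOp a` and `state = id`) sets of finitely supported distributions on all states. -/
structure Framework (X a : Type*) [Fintype a] where
  /-- the set `𝒮` of potential secrets, each of which is a set of states -/
  secrets : Set (Set (DensityOp a))
  /-- the set `𝒬` of discriminative pairs -/
  pairs : Set (Set (DensityOp a) × Set (DensityOp a))
  pairs_mem : ∀ R T, (R, T) ∈ pairs → R ∈ secrets ∧ T ∈ secrets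
  pairs_symm : ∀ R T, (R, T) ∈ pairs → (T, R) ∈ pairs
  pairs_disjoint : ∀ R T, (R, T) ∈ pairs → Disjoint R T
  /-- the states `ρ^x` -/
  state : X → DensityOp a
  /-- the set `Θ` of data distributions -/
  dists : Set (DataDist X)

/-- The secret `(R₁, R₂)` of a pair of systems: the first system is in a state from `R₁` and the
second one in a state from `R₂`, with the two systems in a product state. -/
def prodSecret {a : Type*} [Fintype a] (R₁ R₂ : Set (DensityOp a)) : Set (DensityOp (a × a)) :=
  Set.image2 DensityOp.tensor R₁ R₂

/-- The framework of the parallel composition of two mechanisms: the input is `ρ^{X₁} ⊗ ρ^{X₂}` with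
`X₁`, `X₂` independent and both with the same law from `Θ`, and the discriminative pairs are
`((R₁, R₂), (T₁, T₂))` with `(R₁, T₁)` and `(R₂, T₂)` in `𝒬`. -/
def Framework.square {X a : Type*} [Fintype a] (F : Framework X a) : Framework (X × X) (a × a) where
  secrets := {S | ∃ R₁ ∈ F.secrets, ∃ R₂ ∈ F.secrets, S = prodSecret R₁ R₂}
  pairs := {q | ∃ R₁ T₁ R₂ T₂, (R₁, T₁) ∈ F.pairs ∧ (R₂, T₂) ∈ F.pairs ∧
    q = (prodSecret R₁ R₂, prodSecret T₁ T₂)}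
  pairs_mem := by
    rintro R T ⟨R₁, T₁, R₂, T₂, h₁, h₂, h⟩
    obtain ⟨rfl, rfl⟩ := Prod.mk.inj h
    exact ⟨⟨R₁, (F.pairs_mem _ _ h₁).1, R₂, (F.pairs_mem _ _ h₂).1, rfl⟩,
      ⟨T₁, (F.pairs_mem _ _ h₁).2, T₂, (F.pairs_mem _ _ h₂).2, rfl⟩⟩
  pairs_symm := by
    rintro R T ⟨R₁, T₁, R₂, T₂, h₁, h₂, h⟩
    obtain ⟨rfl, rfl⟩ := Prod.mk.inj h
    exact ⟨T₁, R₁, T₂, R₂, F.pairs_symm _ _ h₁, F.pairs_symm _ _ h₂, rfl⟩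
  pairs_disjoint := by
    rintro R T ⟨R₁, T₁, R₂, T₂, h₁, h₂, h⟩
    obtain ⟨rfl, rfl⟩ := Prod.mk.inj h
    rw [Set.disjoint_left]
    rintro _ ⟨ρ, hρ, σ, hσ, rfl⟩ ⟨ρ', hρ', σ', hσ', h'⟩
    have h'' := (DensityOp.tensor_inj h').1
    subst h''
    exact Set.disjoint_left.1 (F.pairs_disjoint _ _ h₁) hρ hρ'
  state x := (F.state x.1).tensor (F.state x.2)
  dists := DataDist.square '' F.dists

theorem DensityOp.tensor_mem_prodSecret {a : Type*} [Fintype a] {R₁ R₂ : Set (DensityOp a)}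
    {ρ σ : DensityOp a} : ρ.tensor σ ∈ prodSecret R₁ R₂ ↔ ρ ∈ R₁ ∧ σ ∈ R₂ := by
  constructor
  · rintro ⟨ρ', h₁, σ', h₂, h⟩
    obtain ⟨rfl, rfl⟩ := DensityOp.tensor_inj h
    exact ⟨h₁, h₂⟩
  · rintro ⟨h₁, h₂⟩
    exact ⟨ρ, h₁, σ, h₂, rfl⟩

open Classical in
/-- In the composed framework, sums over the data indices of a secret split into double sums. -/
theorem DataDist.sum_square {X a E : Type*} [Fintype a] [AddCommMonoid E] (P : DataDist X)
    (ρ : X → DensityOp a) (R₁ R₂ : Set (DensityOp a)) (f : X × X → E) :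
    ∑ x ∈ P.square.weight.support with (ρ x.1).tensor (ρ x.2) ∈ prodSecret R₁ R₂, f x
      = ∑ x ∈ P.weight.support with ρ x ∈ R₁, ∑ y ∈ P.weight.support with ρ y ∈ R₂, f (x, y) := by
  rw [← Finset.sum_product']
  refine Finset.sum_congr ?_ fun _ _ => rfl
  ext ⟨x, y⟩
  simp only [Finset.mem_filter, Finset.mem_product, DensityOp.tensor_mem_prodSecret,
    Finsupp.mem_support_iff]
  have h : P.square.weight (x, y) = P.weight x * P.weight y := rfl
  rw [h, mul_ne_zero_iff]
  tauto

/-- In the composed framework, a pair of secrets has probability `P_X(R₁) P_X(R₂)`. -/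
theorem Framework.prob_square {X a : Type*} [Fintype a] (F : Framework X a) (P : DataDist X)
    (R₁ R₂ : Set (DensityOp a)) :
    P.square.prob F.square.state (prodSecret R₁ R₂) = P.prob F.state R₁ * P.prob F.state R₂ := by
  unfold DataDist.prob
  rw [Finset.sum_mul_sum]
  exact DataDist.sum_square P F.state R₁ R₂ _

/-- In the composed framework, the state conditioned on a pair of secrets is `ρ^{R₁} ⊗ ρ^{R₂}`. -/
theorem Framework.condState_square {X a : Type*} [Fintype a] (F : Framework X a) (P : DataDist X)
    (R₁ R₂ : Set (DensityOp a)) :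
    P.square.condState F.square.state (prodSecret R₁ R₂)
      = P.condState F.state R₁ ⊗ₖ P.condState F.state R₂ := by
  have h := DataDist.sum_square P F.state R₁ R₂ fun x =>
    ((P.square.weight x / P.square.prob F.square.state (prodSecret R₁ R₂) : ℝ) : ℂ) •
      ((F.state x.1).tensor (F.state x.2)).mat
  refine h.trans ?_
  rw [Framework.prob_square]
  ext u v
  simp only [DataDist.condState, Matrix.sum_apply, Matrix.kroneckerMap_apply, Finset.sum_mul_sum]
  refine Finset.sum_congr rfl fun x _ => Finset.sum_congr rfl fun y _ => ?_
  have h1 : P.square.weight (x, y) = P.weight x * P.weight y := rfl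
  have h2 : ((F.state x).tensor (F.state y)).mat = (F.state x).mat ⊗ₖ (F.state y).mat := rfl
  simp only [h1, h2, Matrix.smul_apply, Matrix.kroneckerMap_apply, smul_eq_mul]
  push_cast
  rw [mul_div_mul_comm]
  ring

/-! ### Quantum pufferfish privacy -/

/-- The set of all measurement operators, `0 ≤ M ≤ I`. On a composite system this includes all joint
measurements. -/
def allMeasurements (b : Type*) [Fintype b] [DecidableEq b] : Set (Matrix b b ℂ) :=
  {M | M.PosSemidef ∧ (1 - M).PosSemidef}

/-- `(ε, δ)`-quantum pufferfish privacy of the mechanism `A` in the framework `(𝒮, 𝒬, Θ, ℳ)`, with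
`(𝒮, 𝒬, Θ)` given by `F`. (The traces are real numbers.) -/
def IsQPP {X a b : Type*} [Fintype a] [Fintype b] (F : Framework X a) (ℳ : Set (Matrix b b ℂ))
    (A : Channel a b) (ε δ : ℝ) : Prop :=
  ∀ P ∈ F.dists, ∀ R T, (R, T) ∈ F.pairs → 0 < P.prob F.state R → 0 < P.prob F.state T →
    ∀ M ∈ ℳ, (M * A.toLin (P.condState F.state R)).trace.re
      ≤ Real.exp ε * (M * A.toLin (P.condState F.state T)).trace.re + δ

end QPP

end

/-! All claims reduce to pairs of states compared by measurement operators `0 ≤ M ≤ I`. Convexity is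
linearity of the trace. Post-processing absorbs the channel into the measurement, since the adjoint
of a channel maps measurement operators to measurement operators.

For a tensor product, fixing a state in one factor turns a joint measurement into a measurement on
the other. Changing one factor at a time yields the bound with the minimum (`Indist.kronecker`,
`Indist.kronecker'`), the two terms coming from the two orders.

For the square-root bound each output `ρ` is first replaced by a nearby `τ ≤ exp ε • σ`
(`Indist.exists_smoothing`). The positive part of `ρ - exp ε • σ` has trace at most `δ`. With `A =
exp ε • σ` and a slightly enlarged positive part `Δ`, the contraction `G = A^{1/2} (A + Δ)^{-1/2}`
gives `τ = G ρ Gᴴ`, and Cauchy-Schwarz bounds the change in measurement probabilities. The dominated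
operators compose with no additive error. As `τ` stays subnormalized, no normalization cost arises:
the bound holds already with `ε₁ + ε₂`, and the logarithm is slack. -/

namespace Matrix

/-! ### Positive semidefinite matrices and trace duality -/

variable {a b : Type*} [Fintype a] [Fintype b]

/-- A complex matrix with nonnegative quadratic form is positive semidefinite. -/
theorem PosSemidef.of_quadraticForm_nonneg {M : Matrix a a ℂ}
    (h : ∀ x, 0 ≤ star x ⬝ᵥ (M *ᵥ x)) : M.PosSemidef := by
  classical
  -- Over `ℂ` the form being real already forces `M` to be Hermitian, and the order on `ℂ` makes `0
  -- ≤ z` include reality of `z`.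
  rw [← Matrix.isPositive_toEuclideanLin_iff, LinearMap.isPositive_iff_complex]
  intro x
  have h1 := Complex.le_def.1 (h x.ofLp)
  have h2 : inner ℂ (Matrix.toEuclideanLin M x) x = star (star x.ofLp ⬝ᵥ (M *ᵥ x.ofLp)) := by
    rw [EuclideanSpace.inner_eq_star_dotProduct, ← Matrix.star_dotProduct_star]
    simp [dotProduct_comm]
  rw [h2]
  constructor
  · apply Complex.ext
    · simp
    · simpa using h1.2.symm
  · simpa using h1.1

open scoped MatrixOrder in
theorem PosSemidef.exists_eq_conjTranspose_mul_self {A : Matrix a a ℂ} (hA : A.PosSemidef) :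
    ∃ C : Matrix a a ℂ, A = Cᴴ * C := by
  classical
  exact CStarAlgebra.nonneg_iff_eq_star_mul_self.1 (nonneg_iff_posSemidef.2 hA)

theorem PosSemidef.trace_mul_nonneg {A B : Matrix a a ℂ} (hA : A.PosSemidef)
    (hB : B.PosSemidef) : 0 ≤ (A * B).trace := by
  classical
  obtain ⟨C, rfl⟩ := hA.exists_eq_conjTranspose_mul_self
  rw [Matrix.mul_assoc, Matrix.trace_mul_comm]
  exact (hB.mul_mul_conjTranspose_same C).trace_nonneg

theorem PosSemidef.re_trace_mul_nonneg {A B : Matrix a a ℂ} (hA : A.PosSemidef)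
    (hB : B.PosSemidef) : 0 ≤ (A * B).trace.re :=
  (Complex.le_def.1 (hA.trace_mul_nonneg hB)).1

/-- Every linear functional on matrices is of the form `X ↦ Tr[M X]`. -/
theorem exists_trace_mul_eq (f : Matrix a a ℂ →ₗ[ℂ] ℂ) :
    ∃ M : Matrix a a ℂ, ∀ X, f X = (M * X).trace := by
  classical
  -- The indices are swapped because pairing `M` with the matrix unit at `(j, i)` extracts the entry
  -- `M i j`.
  refine ⟨Matrix.of fun i j => f (Matrix.single j i 1), fun X => ?_⟩
  conv_lhs => rw [Matrix.matrix_eq_sum_single X]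
  have h : ∀ i j, Matrix.single i j (X i j) = X i j • Matrix.single i j (1 : ℂ) := by
    intro i j; simp [Matrix.smul_single]
  simp only [h, map_sum, map_smul, smul_eq_mul, Matrix.trace, Matrix.diag, Matrix.mul_apply,
    Matrix.of_apply]
  rw [Finset.sum_comm]
  exact Finset.sum_congr rfl fun j _ => Finset.sum_congr rfl fun i _ => mul_comm _ _

/-- Self-duality of the positive cone: rank-one `X = x xᴴ` suffice, since the trace is then the
quadratic form of `M` at `x`. -/
theorem posSemidef_of_trace_mul_nonneg {M : Matrix a a ℂ}
    (h : ∀ X : Matrix a a ℂ, X.PosSemidef → 0 ≤ (M * X).trace) : M.PosSemidef := by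
  refine PosSemidef.of_quadraticForm_nonneg fun x => ?_
  have h1 := h _ (Matrix.posSemidef_vecMulVec_self_star x)
  rwa [Matrix.mul_vecMulVec, Matrix.trace_vecMulVec, dotProduct_comm] at h1

end Matrix

/-! ### Measurements in the Heisenberg picture -/

namespace QPP

variable {a b b₁ b₂ : Type*} [Fintype a] [Fintype b] [Fintype b₁] [Fintype b₂]

/-- A functional between `0` and the trace is given by a measurement operator. -/
theorem exists_measurement [DecidableEq a] (f : Matrix a a ℂ →ₗ[ℂ] ℂ)
    (h0 : ∀ X : Matrix a a ℂ, X.PosSemidef → 0 ≤ f X)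
    (h1 : ∀ X : Matrix a a ℂ, X.PosSemidef → f X ≤ X.trace) :
    ∃ M ∈ allMeasurements a, ∀ X, f X = (M * X).trace := by
  obtain ⟨M, hM⟩ := Matrix.exists_trace_mul_eq f
  refine ⟨M, ⟨?_, ?_⟩, hM⟩
  · exact Matrix.posSemidef_of_trace_mul_nonneg fun X hX => hM X ▸ h0 X hX
  · refine Matrix.posSemidef_of_trace_mul_nonneg fun X hX => ?_
    rw [Matrix.sub_mul, Matrix.one_mul, Matrix.trace_sub, ← hM, sub_nonneg]
    exact h1 X hX

/-- The Heisenberg-picture measurement of `M` on the first factor of a product operator. -/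
theorem exists_measurement_left [DecidableEq b₁] [DecidableEq b₂]
    {M : Matrix (b₁ × b₂) (b₁ × b₂) ℂ}
    (hM : M ∈ allMeasurements (b₁ × b₂)) {Y : Matrix b₂ b₂ ℂ} (hY : Y.PosSemidef)
    (hY1 : Y.trace ≤ 1) :
    ∃ M' ∈ allMeasurements b₁, ∀ X, (M * (X ⊗ₖ Y)).trace = (M' * X).trace := by
  refine exists_measurement
    { toFun := fun X => (M * (X ⊗ₖ Y)).trace
      map_add' := fun X X' => by rw [Matrix.add_kronecker, Matrix.mul_add, Matrix.trace_add]
      map_smul' := fun t X => by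
        rw [Matrix.smul_kronecker, Matrix.mul_smul, Matrix.trace_smul, RingHom.id_apply] }
    (fun X hX => hM.1.trace_mul_nonneg (hX.kronecker hY)) fun X hX => ?_
  -- Positivity of `1 - M` bounds the functional by `Tr X * Tr Y`. Only `Tr Y ≤ 1` is needed, so
  -- subnormalized operators are allowed in the fixed factor.
  have h := hM.2.trace_mul_nonneg (hX.kronecker hY)
  rw [Matrix.sub_mul, Matrix.one_mul, Matrix.trace_sub, sub_nonneg, Matrix.trace_kronecker] at h
  exact h.trans (mul_le_of_le_one_right hX.trace_nonneg hY1)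

theorem exists_measurement_right [DecidableEq b₁] [DecidableEq b₂]
    {M : Matrix (b₁ × b₂) (b₁ × b₂) ℂ}
    (hM : M ∈ allMeasurements (b₁ × b₂)) {X : Matrix b₁ b₁ ℂ} (hX : X.PosSemidef)
    (hX1 : X.trace ≤ 1) :
    ∃ M' ∈ allMeasurements b₂, ∀ Y, (M * (X ⊗ₖ Y)).trace = (M' * Y).trace := by
  refine exists_measurement
    { toFun := fun Y => (M * (X ⊗ₖ Y)).trace
      map_add' := fun Y Y' => by rw [Matrix.kronecker_add, Matrix.mul_add, Matrix.trace_add]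
      map_smul' := fun t Y => by
        rw [Matrix.kronecker_smul, Matrix.mul_smul, Matrix.trace_smul, RingHom.id_apply] }
    (fun Y hY => hM.1.trace_mul_nonneg (hX.kronecker hY)) fun Y hY => ?_
  have h := hM.2.trace_mul_nonneg (hX.kronecker hY)
  rw [Matrix.sub_mul, Matrix.one_mul, Matrix.trace_sub, sub_nonneg, Matrix.trace_kronecker] at h
  exact h.trans (mul_le_of_le_one_left hY.trace_nonneg hX1)

/-- Complete positivity with a one-dimensional reference system. -/
theorem Channel.posSemidef (A : Channel a b) {Y : Matrix a a ℂ} (hY : Y.PosSemidef) :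
    (A.toLin Y).PosSemidef :=
  (A.completelyPositive.ampliation Unit (hY.submatrix Prod.snd)).submatrix (fun i => ((), i))

/-- Positivity of the channel gives the lower bound on the pulled-back functional, trace
preservation the upper one. -/
theorem Channel.exists_measurement [DecidableEq a] [DecidableEq b] (A : Channel a b)
    {M : Matrix b b ℂ} (hM : M ∈ allMeasurements b) :
    ∃ M' ∈ allMeasurements a, ∀ X, (M * A.toLin X).trace = (M' * X).trace := by
  refine QPP.exists_measurement
    (Matrix.traceLinearMap _ ℂ ℂ ∘ₗ LinearMap.mulLeft ℂ M ∘ₗ A.toLin)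
    (fun X hX => hM.1.trace_mul_nonneg (A.posSemidef hX)) fun X hX => ?_
  have h := hM.2.trace_mul_nonneg (A.posSemidef hX)
  rw [Matrix.sub_mul, Matrix.one_mul, Matrix.trace_sub, sub_nonneg, A.trace_preserving] at h
  exact h

variable {X : Type*}

theorem DataDist.condState_posSemidef (P : DataDist X) (ρ : X → DensityOp a)
    (R : Set (DensityOp a)) : (P.condState ρ R).PosSemidef := by
  classical
  refine Matrix.posSemidef_sum _ fun x _ => (ρ x).2.1.smul ?_
  have h : 0 ≤ P.prob ρ R := Finset.sum_nonneg fun x _ => P.nonneg x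
  exact_mod_cast div_nonneg (P.nonneg x) h

theorem DataDist.condState_trace (P : DataDist X) (ρ : X → DensityOp a)
    (R : Set (DensityOp a)) (h : 0 < P.prob ρ R) : (P.condState ρ R).trace = 1 := by
  classical
  have h1 : ∀ x, (ρ x).mat.trace = 1 := fun x => (ρ x).2.2
  unfold DataDist.condState
  simp only [Matrix.trace_sum, Matrix.trace_smul, h1, smul_eq_mul, mul_one]
  rw [← Complex.ofReal_sum, ← Finset.sum_div]
  rw [show (∑ x ∈ P.weight.support with ρ x ∈ R, P.weight x) = P.prob ρ R from ?_, div_self h.ne',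
    Complex.ofReal_one]
  unfold DataDist.prob
  congr

/-! ### Indistinguishability and composition one factor at a time -/

/-- `ρ` is `(ε, δ)`-indistinguishable from `σ` (in one direction): every measurement operator
satisfies the `(ε, δ)` inequality. -/
def Indist [DecidableEq b] (ρ σ : Matrix b b ℂ) (ε δ : ℝ) : Prop :=
  ∀ M ∈ allMeasurements b, (M * ρ).trace.re ≤ Real.exp ε * (M * σ).trace.re + δ

theorem Indist.mono [DecidableEq b] {ρ σ : Matrix b b ℂ} {ε ε' δ δ' : ℝ}
    (hσ : σ.PosSemidef) (h : Indist ρ σ ε δ) (hε : ε ≤ ε') (hδ : δ ≤ δ') : Indist ρ σ ε' δ' :=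
  fun M hM => (h M hM).trans <| add_le_add (mul_le_mul_of_nonneg_right (Real.exp_le_exp.2 hε)
    (hM.1.re_trace_mul_nonneg hσ)) hδ

/-- Hybrid argument through `σ₁ ⊗ₖ ρ₂`: the error `δ₂` of the second exchange is amplified by the
factor `exp ε₁` of the first. -/
theorem Indist.kronecker [DecidableEq b₁] [DecidableEq b₂] {ρ₁ σ₁ : Matrix b₁ b₁ ℂ}
    {ρ₂ σ₂ : Matrix b₂ b₂ ℂ} {ε₁ ε₂ δ₁ δ₂ : ℝ} (h₁ : Indist ρ₁ σ₁ ε₁ δ₁) (h₂ : Indist ρ₂ σ₂ ε₂ δ₂)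
    (hρ₂ : ρ₂.PosSemidef) (hρ₂' : ρ₂.trace ≤ 1) (hσ₁ : σ₁.PosSemidef) (hσ₁' : σ₁.trace ≤ 1) :
    Indist (ρ₁ ⊗ₖ ρ₂) (σ₁ ⊗ₖ σ₂) (ε₁ + ε₂) (δ₁ + Real.exp ε₁ * δ₂) := by
  intro M hM
  obtain ⟨M₁, hM₁, e₁⟩ := exists_measurement_left hM hρ₂ hρ₂'
  obtain ⟨M₂, hM₂, e₂⟩ := exists_measurement_right hM hσ₁ hσ₁'
  have i₁ := h₁ M₁ hM₁
  have i₂ := mul_le_mul_of_nonneg_left (h₂ M₂ hM₂) (Real.exp_nonneg ε₁)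
  rw [← e₁, ← e₁] at i₁
  rw [← e₂, ← e₂] at i₂
  rw [Real.exp_add]
  linarith

/-- The opposite order of exchange, through `ρ₁ ⊗ₖ σ₂`. -/
theorem Indist.kronecker' [DecidableEq b₁] [DecidableEq b₂] {ρ₁ σ₁ : Matrix b₁ b₁ ℂ}
    {ρ₂ σ₂ : Matrix b₂ b₂ ℂ} {ε₁ ε₂ δ₁ δ₂ : ℝ} (h₁ : Indist ρ₁ σ₁ ε₁ δ₁) (h₂ : Indist ρ₂ σ₂ ε₂ δ₂)
    (hρ₁ : ρ₁.PosSemidef) (hρ₁' : ρ₁.trace ≤ 1) (hσ₂ : σ₂.PosSemidef) (hσ₂' : σ₂.trace ≤ 1) :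
    Indist (ρ₁ ⊗ₖ ρ₂) (σ₁ ⊗ₖ σ₂) (ε₁ + ε₂) (δ₂ + Real.exp ε₂ * δ₁) := by
  intro M hM
  obtain ⟨M₁, hM₁, e₁⟩ := exists_measurement_left hM hσ₂ hσ₂'
  obtain ⟨M₂, hM₂, e₂⟩ := exists_measurement_right hM hρ₁ hρ₁'
  have i₁ := h₂ M₂ hM₂
  have i₂ := mul_le_mul_of_nonneg_left (h₁ M₁ hM₁) (Real.exp_nonneg ε₂)
  rw [← e₁, ← e₁] at i₂
  rw [← e₂, ← e₂] at i₁
  rw [Real.exp_add]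
  linarith

end QPP

/-! ### Cauchy-Schwarz, positive parts and the smoothing contraction -/

namespace Matrix

variable {a : Type*} [Fintype a]

/-- The Cauchy-Schwarz inequality for the form `(X, Y) ↦ Tr[Xᴴ M Y ρ]`, at `X = 1` and `Y = G`. -/
theorem PosSemidef.re_trace_mul_sq_le {M ρ : Matrix a a ℂ} (hM : M.PosSemidef)
    (hρ : ρ.PosSemidef) (G : Matrix a a ℂ) :
    (M * G * ρ).trace.re ^ 2 ≤ (M * ρ).trace.re * (M * (G * ρ * Gᴴ)).trace.re := by
  classical
  -- The quadratic in `t` is `Tr[M (1 + tG) ρ (1 + tG)ᴴ]`; its discriminant is therefore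
  -- nonpositive.
  have key : ∀ t : ℝ, 0 ≤ (M * (G * ρ * Gᴴ)).trace.re * (t * t)
      + (2 * (M * G * ρ).trace.re) * t + (M * ρ).trace.re := by
    intro t
    have h := hM.re_trace_mul_nonneg (hρ.mul_mul_conjTranspose_same (1 + (t : ℂ) • G))
    have e1 : (M * ((1 + (t : ℂ) • G) * ρ * (1 + (t : ℂ) • G)ᴴ)).trace
        = (M * ρ).trace + t * (M * G * ρ).trace + t * (M * ρ * Gᴴ).trace
          + (t * t) * (M * (G * ρ * Gᴴ)).trace := by
      simp only [conjTranspose_add, conjTranspose_one, conjTranspose_smul, Complex.star_def,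
        Complex.conj_ofReal, add_mul, mul_add, one_mul, mul_one, smul_mul_assoc, mul_smul_comm,
        trace_add, trace_smul, smul_eq_mul, Matrix.mul_assoc]
      ring
    have e2 : (M * ρ * Gᴴ).trace = star (M * G * ρ).trace := by
      rw [← trace_conjTranspose, conjTranspose_mul, conjTranspose_mul, hM.1.eq, hρ.1.eq,
        trace_mul_comm, ← Matrix.mul_assoc, trace_mul_comm, ← Matrix.mul_assoc, trace_mul_comm,
        ← Matrix.mul_assoc]
    rw [e1, e2] at h
    simp at h
    linarith
  have := discrim_le_zero key
  rw [discrim] at this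
  nlinarith

/-- The positive part `Δ` of a Hermitian matrix `H`, with the spectral projection `P`. -/
theorem IsHermitian.exists_posPart [DecidableEq a] {H : Matrix a a ℂ} (hH : H.IsHermitian) :
    ∃ Δ P : Matrix a a ℂ, Δ.PosSemidef ∧ (Δ - H).PosSemidef ∧ P.PosSemidef ∧ (1 - P).PosSemidef ∧
      P * H = Δ := by
  set U : Matrix a a ℂ := ↑hH.eigenvectorUnitary
  have hUU : Uᴴ * U = 1 := Unitary.coe_star_mul_self hH.eigenvectorUnitary
  have hUU' : U * Uᴴ = 1 := Unitary.coe_mul_star_self hH.eigenvectorUnitary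
  set d := hH.eigenvalues
  have hs : H = U * diagonal (fun i => (d i : ℂ)) * Uᴴ := hH.spectral_theorem
  have hD : ∀ f : a → ℝ, (∀ i, 0 ≤ f i) → (U * diagonal (fun i => (f i : ℂ)) * Uᴴ).PosSemidef :=
    fun f hf => (PosSemidef.diagonal (fun i => Complex.zero_le_real.2 (hf i))).mul_mul_conjTranspose_same U
  refine ⟨U * diagonal (fun i => ((max (d i) 0 : ℝ) : ℂ)) * Uᴴ,
    U * diagonal (fun i => ((if 0 < d i then 1 else 0 : ℝ) : ℂ)) * Uᴴ, hD _ fun i => le_max_right _ _,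
    ?_, hD _ fun i => by split_ifs <;> norm_num, ?_, ?_⟩
  · have := hD (fun i => max (d i) 0 - d i) fun i => sub_nonneg.2 (le_max_left _ _)
    convert this using 1
    conv_lhs => rw [hs]
    rw [← Matrix.sub_mul, ← Matrix.mul_sub, diagonal_sub]
    push_cast
    rfl
  · have := hD (fun i => 1 - if 0 < d i then 1 else 0) fun i => by split_ifs <;> norm_num
    convert this using 1
    rw [show (1 : Matrix a a ℂ) = U * 1 * Uᴴ by rw [Matrix.mul_one, hUU'], ← Matrix.sub_mul,
      ← Matrix.mul_sub, ← diagonal_one, diagonal_sub]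
    push_cast
    rfl
  · conv_lhs => rw [hs]
    rw [show ∀ A B : Matrix a a ℂ, U * A * Uᴴ * (U * B * Uᴴ) = U * (A * (Uᴴ * U) * B) * Uᴴ by
      intro A B; simp only [Matrix.mul_assoc], hUU, Matrix.mul_one, diagonal_mul_diagonal]
    congr 3
    ext i
    rw [← Complex.ofReal_mul]
    congr 1
    split_ifs with h
    · rw [one_mul, max_eq_left h.le]
    · rw [zero_mul, max_eq_right (not_lt.1 h)]

open scoped MatrixOrder Matrix.Norms.L2Operator in
/-- Square roots of positive semidefinite matrices, and their monotonicity. -/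
theorem exists_sqrt_mono [DecidableEq a] {A B : Matrix a a ℂ} (hA : A.PosSemidef)
    (hAB : (B - A).PosSemidef) : ∃ S T : Matrix a a ℂ, S.PosSemidef ∧ T.PosSemidef ∧
      (T - S).PosSemidef ∧ S * S = A ∧ T * T = B := by
  have hA' : 0 ≤ A := nonneg_iff_posSemidef.2 hA
  have hAB' : A ≤ B := le_iff.2 hAB
  exact ⟨CFC.sqrt A, CFC.sqrt B, nonneg_iff_posSemidef.1 (CFC.sqrt_nonneg A),
    nonneg_iff_posSemidef.1 (CFC.sqrt_nonneg B), le_iff.1 (CFC.sqrt_le_sqrt _ _ hAB'),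
    CFC.sqrt_mul_sqrt_self A hA', CFC.sqrt_mul_sqrt_self B (hA'.trans hAB')⟩

/-- If `ρ ≤ A + Δ` then some contraction `G`, close to the identity on `ρ`, satisfies
`G ρ Gᴴ ≤ A`. -/
theorem PosSemidef.exists_contraction [DecidableEq a] {ρ A Δ : Matrix a a ℂ} (hA : A.PosSemidef)
    (hΔ : Δ.PosDef) (hle : (A + Δ - ρ).PosSemidef) :
    ∃ G : Matrix a a ℂ, (1 - Gᴴ * G).PosSemidef ∧ (A - G * ρ * Gᴴ).PosSemidef ∧
      ρ.trace.re - Δ.trace.re ≤ (G * ρ).trace.re := by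
  -- `S` and `T` are the square roots of `A` and `A + Δ`, and `G = S T⁻¹`, so that `G (A + Δ) Gᴴ =
  -- A`. Positive definiteness of `Δ` makes `T` invertible.
  obtain ⟨S, T, hS, hT, hST, hSS, hTT⟩ := exists_sqrt_mono (B := A + Δ) hA
    (by simpa using hΔ.posSemidef)
  have hB : (A + Δ).PosDef := hΔ.posSemidef_add hA
  have hTu : IsUnit T.det := by
    have := (Matrix.isUnit_iff_isUnit_det _).1 hB.isUnit
    rw [← hTT, det_mul] at this
    exact isUnit_of_mul_isUnit_left this
  have hT1 : T * T⁻¹ = 1 := mul_nonsing_inv T hTu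
  have hT2 : T⁻¹ * T = 1 := nonsing_inv_mul T hTu
  have hTi : (T⁻¹)ᴴ = T⁻¹ := hT.inv.1.eq
  have hGH : (S * T⁻¹)ᴴ = T⁻¹ * S := by rw [conjTranspose_mul, hTi, hS.1.eq]
  -- `1 - Gᴴ G = T⁻¹ Δ T⁻¹`.
  have hG1 : (1 - (S * T⁻¹)ᴴ * (S * T⁻¹)).PosSemidef := by
    have h := hΔ.posSemidef.mul_mul_conjTranspose_same T⁻¹
    convert h using 1
    rw [hGH, hTi, ← Matrix.mul_assoc, Matrix.mul_assoc T⁻¹ S S, hSS,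
      show Δ = T * T - A by rw [hTT]; simp, Matrix.mul_sub, Matrix.sub_mul, ← Matrix.mul_assoc, hT2,
      Matrix.one_mul, hT1]
  refine ⟨S * T⁻¹, hG1, ?_, ?_⟩
  · have h := hle.mul_mul_conjTranspose_same (S * T⁻¹)
    convert h using 1
    rw [Matrix.mul_sub, Matrix.sub_mul, ← hTT, ← Matrix.mul_assoc (S * T⁻¹), Matrix.mul_assoc S T⁻¹ T,
      hT2, Matrix.mul_one, hGH,
      Matrix.mul_assoc S T, ← Matrix.mul_assoc T T⁻¹ S, hT1, Matrix.one_mul, hSS]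
  · set G := S * T⁻¹
    -- `2 - G - Gᴴ = (1 - G)ᴴ (1 - G) + (1 - Gᴴ G)`. Pairing it with `A + Δ - ρ ≥ 0` gives `Re Tr[(1
    -- - G) ρ] ≤ Re Tr[(1 - G)(A + Δ)]`.
    have hK : (2 - G - Gᴴ).PosSemidef := by
      have h := (posSemidef_conjTranspose_mul_self (1 - G)).add hG1
      convert h using 1
      rw [conjTranspose_sub, conjTranspose_one, ← one_add_one_eq_two]
      noncomm_ring
    have h1 := hK.re_trace_mul_nonneg hle
    have hstar : ∀ {X : Matrix a a ℂ}, X.IsHermitian → (Gᴴ * X).trace.re = (G * X).trace.re := by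
      intro X hX
      rw [trace_mul_comm, ← Complex.conj_re, ← Complex.star_def, ← trace_conjTranspose,
        conjTranspose_mul, hX.eq, conjTranspose_conjTranspose]
    have hρ : ρ.IsHermitian := by
      have := hB.1.sub hle.1
      simpa using this
    have e : ∀ X : Matrix a a ℂ, ((2 - G - Gᴴ) * X).trace.re
        = 2 * X.trace.re - (G * X).trace.re - (Gᴴ * X).trace.re := by
      intro X
      have : (2 - G - Gᴴ) * X = X + X - G * X - Gᴴ * X := by noncomm_ring
      rw [this]
      simp
      ring
    -- Operator monotonicity of the square root gives `Tr[S T] ≥ Tr[S S] = Tr A`. As `G (A + Δ) = S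
    -- T`, the right side above is at most `Tr Δ`.
    have h2 := hS.re_trace_mul_nonneg hST
    rw [Matrix.mul_sub, hSS, trace_sub, Complex.sub_re] at h2
    have h3 : G * (A + Δ) = S * T := by
      rw [← hTT, ← Matrix.mul_assoc, Matrix.mul_assoc S, hT2, Matrix.mul_one]
    rw [e, Matrix.mul_sub, Matrix.mul_sub, trace_sub, trace_sub, trace_sub, Complex.sub_re,
      Complex.sub_re, Complex.sub_re, hstar hB.1, hstar hρ, h3, trace_add, Complex.add_re] at h1
    linarith

end Matrix

/-- The two-outcome Fuchs-van de Graaf inequality. With `x = cos² α` and `y = cos² β`, the sum of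
roots is `cos (α - β)` and `x - y = sin (β - α) sin (α + β)`. -/
theorem Real.sub_sq_add_sq_le_one {x y c : ℝ} (hx : 0 ≤ x) (hx1 : x ≤ 1) (hy : 0 ≤ y) (hy1 : y ≤ 1)
    (hc : 0 ≤ c) (h : c ≤ √(x * y) + √((1 - x) * (1 - y))) : (x - y) ^ 2 + c ^ 2 ≤ 1 := by
  have hx' : 0 ≤ 1 - x := by linarith
  have hy' : 0 ≤ 1 - y := by linarith
  rw [Real.sqrt_mul hx, Real.sqrt_mul hx'] at h
  have h1 := Real.sq_sqrt hx
  have h2 := Real.sq_sqrt hy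
  have h3 := Real.sq_sqrt hx'
  have h4 := Real.sq_sqrt hy'
  set p := √x
  set q := √y
  set r := √(1 - x)
  set s := √(1 - y)
  have hcc : c ^ 2 ≤ (p * q + r * s) ^ 2 := pow_le_pow_left₀ hc h 2
  have e1 : (p * q + r * s) ^ 2 + (p * s - q * r) ^ 2 = 1 := by
    have : (p * q + r * s) ^ 2 + (p * s - q * r) ^ 2 = (p ^ 2 + r ^ 2) * (q ^ 2 + s ^ 2) := by ring
    rw [this, h1, h2, h3, h4]; ring
  have e2 : (p * s + q * r) ^ 2 + (p * q - r * s) ^ 2 = 1 := by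
    have : (p * s + q * r) ^ 2 + (p * q - r * s) ^ 2 = (p ^ 2 + r ^ 2) * (q ^ 2 + s ^ 2) := by ring
    rw [this, h1, h2, h3, h4]; ring
  have e3 : x - y = (p * s - q * r) * (p * s + q * r) := by
    have : (p * s - q * r) * (p * s + q * r) = p ^ 2 * s ^ 2 - q ^ 2 * r ^ 2 := by ring
    rw [this, h1, h2, h3, h4]; ring
  have e4 : (x - y) ^ 2 ≤ (p * s - q * r) ^ 2 := by
    rw [e3, mul_pow]
    exact mul_le_of_le_one_right (sq_nonneg _) (by nlinarith [sq_nonneg (p * q - r * s)])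
  linarith

/-! ### Smoothing and the square-root composition bound -/

namespace QPP

open scoped Matrix

variable {b b₁ b₂ : Type*} [Fintype b] [Fintype b₁] [Fintype b₂]

/-- A contraction that is close to the identity on `ρ` changes measurement probabilities little. -/
theorem trace_measurement_contraction_le [DecidableEq b] {M ρ G : Matrix b b ℂ}
    (hM : M ∈ allMeasurements b) (hρ : ρ.PosSemidef) (hρ1 : ρ.trace = 1)
    (hG : (1 - Gᴴ * G).PosSemidef) {δ : ℝ} (hδ1 : δ ≤ 1) (hGρ : 1 - δ ≤ (G * ρ).trace.re) :
    (M * ρ).trace.re ≤ (M * (G * ρ * Gᴴ)).trace.re + √(δ * (2 - δ)) := by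
  have hρ' := hρ.mul_mul_conjTranspose_same G
  have hn : (G * ρ * Gᴴ).trace.re ≤ 1 := by
    have h := hG.re_trace_mul_nonneg hρ
    rw [Matrix.sub_mul, Matrix.one_mul, Matrix.trace_sub, Complex.sub_re, hρ1, Complex.one_re,
      Matrix.mul_assoc, Matrix.trace_mul_comm] at h
    linarith
  -- Cauchy-Schwarz for both outcomes `M` and `1 - M`; the two cross terms add up to `Tr[G ρ]`, of
  -- real part at least `1 - δ`.
  have cs := hM.1.re_trace_mul_sq_le hρ G
  have cs' := hM.2.re_trace_mul_sq_le hρ G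
  have x0 := hM.1.re_trace_mul_nonneg hρ
  have x1 := hM.2.re_trace_mul_nonneg hρ
  have y0 := hM.1.re_trace_mul_nonneg hρ'
  have y1 := hM.2.re_trace_mul_nonneg hρ'
  simp only [Matrix.sub_mul, Matrix.one_mul, Matrix.trace_sub, Complex.sub_re, hρ1,
    Complex.one_re] at cs' x1 y1
  set x := (M * ρ).trace.re
  set y := (M * (G * ρ * Gᴴ)).trace.re
  set z := (M * G * ρ).trace.re
  have hz : z ≤ √(x * y) := Real.le_sqrt_of_sq_le cs
  -- `Tr[G ρ Gᴴ] ≤ 1` lets `1 - y` replace the probability of the second outcome.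
  have hz' : (G * ρ).trace.re - z ≤ √((1 - x) * (1 - y)) :=
    Real.le_sqrt_of_sq_le (cs'.trans (mul_le_mul_of_nonneg_left (by linarith) x1))
  have h := Real.sub_sq_add_sq_le_one (c := 1 - δ) x0 (by linarith) y0 (by linarith) (by linarith)
    (by linarith)
  -- `1 - (1 - δ)² = δ (2 - δ)`.
  have : x - y ≤ √(δ * (2 - δ)) := Real.le_sqrt_of_sq_le (by linarith)
  linarith

/-- Smoothing: an `(ε, δ)`-indistinguishable state is close to a subnormalized state that is
dominated by `exp ε • σ`. -/
theorem Indist.exists_smoothing [DecidableEq b] {ρ σ : Matrix b b ℂ} {ε δ δ' : ℝ}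
    (h : Indist ρ σ ε δ) (hρ : ρ.PosSemidef) (hρ1 : ρ.trace = 1) (hσ : σ.PosSemidef)
    (hδ : δ < δ') (hδ1 : δ' ≤ 1) :
    ∃ τ : Matrix b b ℂ, τ.PosSemidef ∧ τ.trace ≤ 1 ∧ Indist τ σ ε 0 ∧
      Indist ρ τ 0 √(δ' * (2 - δ')) := by
  have hA : ((Real.exp ε : ℂ) • σ).PosSemidef := hσ.smul (by exact_mod_cast (Real.exp_nonneg ε))
  obtain ⟨Δ, P, hΔ, hΔ', hP, hP', hPΔ⟩ := (hρ.1.sub hA.1).exists_posPart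
  -- The spectral projection `P` is itself a measurement, and testing `h` on it gives the trace of
  -- the positive part.
  have hΔtr : Δ.trace.re ≤ δ := by
    have := h P ⟨hP, hP'⟩
    rw [← hPΔ, Matrix.mul_sub, Matrix.trace_sub, Matrix.mul_smul, Matrix.trace_smul,
      smul_eq_mul, Complex.sub_re, Complex.re_ofReal_mul]
    linarith
  -- Adding `η • 1` makes the positive part definite; the gap `δ' - δ` pays for the extra trace.
  obtain ⟨η, hη, hηc⟩ : ∃ η : ℝ, 0 < η ∧ η * Fintype.card b ≤ δ' - δ := by
    refine ⟨(δ' - δ) / (Fintype.card b + 1), div_pos (by linarith) (by positivity), ?_⟩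
    rw [div_mul_eq_mul_div, div_le_iff₀ (by positivity)]
    nlinarith
  have hη1 : ((η : ℂ) • (1 : Matrix b b ℂ)).PosDef := Matrix.PosDef.one.smul (by exact_mod_cast hη)
  obtain ⟨G, hG, hGA, hGρ⟩ := hA.exists_contraction (ρ := ρ) (Matrix.PosDef.posSemidef_add hΔ hη1) (by
    convert hΔ'.add hη1.posSemidef using 1
    abel)
  have htr : (Δ + (η : ℂ) • (1 : Matrix b b ℂ)).trace.re ≤ δ' := by
    rw [Matrix.trace_add, Matrix.trace_smul, Matrix.trace_one]
    simp
    linarith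
  rw [hρ1, Complex.one_re] at hGρ
  have hτ := hρ.mul_mul_conjTranspose_same G
  refine ⟨G * ρ * Gᴴ, hτ, ?_, fun M hM => ?_, fun M hM => ?_⟩
  · have h := hG.trace_mul_nonneg hρ
    rwa [Matrix.sub_mul, Matrix.one_mul, Matrix.trace_sub, hρ1, sub_nonneg,
      Matrix.mul_assoc, Matrix.trace_mul_comm] at h
  · have h := hM.1.re_trace_mul_nonneg hGA
    rw [Matrix.mul_sub, Matrix.trace_sub, Matrix.mul_smul, Matrix.trace_smul,
      smul_eq_mul, Complex.sub_re, Complex.re_ofReal_mul] at h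
    linarith
  · rw [Real.exp_zero, one_mul]
    exact trace_measurement_contraction_le hM hρ hρ1 hG hδ1 (by linarith)

theorem Indist.trans [DecidableEq b] {ρ σ τ : Matrix b b ℂ} {ε δ : ℝ}
    (h : Indist ρ τ 0 δ) (h' : Indist τ σ ε 0) : Indist ρ σ ε δ := by
  intro M hM
  have h1 := h M hM
  have h2 := h' M hM
  rw [Real.exp_zero, one_mul] at h1
  linarith

theorem Indist.kronecker_sqrt [DecidableEq b₁] [DecidableEq b₂] {ρ₁ σ₁ : Matrix b₁ b₁ ℂ}
    {ρ₂ σ₂ : Matrix b₂ b₂ ℂ} {ε₁ ε₂ δ₁ δ₂ : ℝ} (h₁ : Indist ρ₁ σ₁ ε₁ δ₁) (h₂ : Indist ρ₂ σ₂ ε₂ δ₂)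
    (hρ₁ : ρ₁.PosSemidef) (hρ₁' : ρ₁.trace = 1) (hσ₁ : σ₁.PosSemidef) (hσ₁' : σ₁.trace = 1)
    (hρ₂ : ρ₂.PosSemidef) (hρ₂' : ρ₂.trace = 1) (hσ₂ : σ₂.PosSemidef)
    (hδ₁ : δ₁ < 1) (hδ₂ : δ₂ < 1) :
    Indist (ρ₁ ⊗ₖ ρ₂) (σ₁ ⊗ₖ σ₂) (ε₁ + ε₂) (√(δ₁ * (2 - δ₁)) + √(δ₂ * (2 - δ₂))) := by
  -- Smoothing requires strict slack `t` in each `δᵢ`, removed afterwards by letting `t` tend to `0`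
  -- from above.
  have key : ∀ t : ℝ, 0 < t → t < min (1 - δ₁) (1 - δ₂) → Indist (ρ₁ ⊗ₖ ρ₂) (σ₁ ⊗ₖ σ₂) (ε₁ + ε₂)
      (√((δ₁ + t) * (2 - (δ₁ + t))) + √((δ₂ + t) * (2 - (δ₂ + t)))) := by
    intro t ht ht'
    obtain ⟨ht₁, ht₂⟩ := lt_min_iff.1 ht'
    obtain ⟨τ₁, p₁, q₁, r₁, s₁⟩ := h₁.exists_smoothing hρ₁ hρ₁' hσ₁
      (lt_add_of_pos_right δ₁ ht) (by linarith)
    obtain ⟨τ₂, p₂, q₂, r₂, s₂⟩ := h₂.exists_smoothing hρ₂ hρ₂' hσ₂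
      (lt_add_of_pos_right δ₂ ht) (by linarith)
    -- Passing from `ρᵢ` to `τᵢ` has zero exponent, so the errors add without amplification; passing
    -- from `τᵢ` to `σᵢ` has zero error, so only the exponents add.
    have i₁ := s₁.kronecker s₂ hρ₂ hρ₂'.le p₁ q₁
    have i₂ := r₁.kronecker r₂ p₂ q₂ hσ₁ hσ₁'.le
    rw [Real.exp_zero, one_mul, add_zero] at i₁
    rw [mul_zero, add_zero] at i₂
    exact i₁.trans i₂
  intro M hM
  have hc : Continuous fun t : ℝ => Real.exp (ε₁ + ε₂) * (M * (σ₁ ⊗ₖ σ₂)).trace.re +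
      (√((δ₁ + t) * (2 - (δ₁ + t))) + √((δ₂ + t) * (2 - (δ₂ + t)))) := by fun_prop
  have hlim := (hc.tendsto 0).mono_left (nhdsWithin_le_nhds (s := Set.Ioi (0 : ℝ)))
  simp only [add_zero] at hlim
  refine ge_of_tendsto hlim ?_
  have hpos : 0 < min (1 - δ₁) (1 - δ₂) := lt_min (by linarith) (by linarith)
  filter_upwards [Ioo_mem_nhdsGT hpos] with t ht
  exact key t ht.1 ht.2 M hM

end QPP

/-! ### From pairs of states to pufferfish privacy -/

namespace QPP

variable {X a b b₁ b₂ c : Type*} [Fintype a] [Fintype b] [Fintype c] [Fintype b₁] [Fintype b₂]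

theorem isQPP_mix [DecidableEq b] {F : Framework X a} {ε δ : ℝ} {k : ℕ} {A : Fin k → Channel a b}
    {p : Fin k → ℝ} (hp : p ∈ stdSimplex ℝ (Fin k))
    (h : ∀ i, IsQPP F (allMeasurements b) (A i) ε δ) :
    IsQPP F (allMeasurements b) (Channel.mix p hp A) ε δ := by
  intro P hP R T hRT hR hT M hM
  have e : ∀ Y, (M * (Channel.mix p hp A).toLin Y).trace.re
      = ∑ i, p i * (M * (A i).toLin Y).trace.re := by
    intro Y
    simp [Channel.mix, LinearMap.sum_apply, Matrix.mul_sum, Matrix.trace_sum]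
  rw [e, e, Finset.mul_sum]
  have h1 : δ = ∑ i, p i * δ := by rw [← Finset.sum_mul, hp.2, one_mul]
  conv_rhs => rw [h1]
  rw [← Finset.sum_add_distrib]
  refine Finset.sum_le_sum fun i _ => ?_
  have := mul_le_mul_of_nonneg_left (h i P hP R T hRT hR hT M hM) (hp.1 i)
  linarith

theorem IsQPP.comp [DecidableEq b] [DecidableEq c] {F : Framework X a} {ε δ : ℝ} {A : Channel a b}
    (h : IsQPP F (allMeasurements b) A ε δ) (N : Channel b c) :
    IsQPP F (allMeasurements c) (N.comp A) ε δ := by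
  intro P hP R T hRT hR hT M hM
  obtain ⟨M', hM', e⟩ := N.exists_measurement hM
  have := h P hP R T hRT hR hT M' hM'
  rwa [← e, ← e] at this

/-- Privacy of a parallel composition follows from a composition result for pairs of states. -/
theorem isQPP_square_tensor [DecidableEq b₁] [DecidableEq b₂] {F : Framework X a}
    {A₁ : Channel a b₁} {A₂ : Channel a b₂} {ε₁ ε₂ δ₁ δ₂ ε δ : ℝ}
    (h₁ : IsQPP F (allMeasurements b₁) A₁ ε₁ δ₁) (h₂ : IsQPP F (allMeasurements b₂) A₂ ε₂ δ₂)
    (h : ∀ (ρ₁ σ₁ : Matrix b₁ b₁ ℂ) (ρ₂ σ₂ : Matrix b₂ b₂ ℂ), Indist ρ₁ σ₁ ε₁ δ₁ →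
      Indist ρ₂ σ₂ ε₂ δ₂ → ρ₁.PosSemidef → ρ₁.trace = 1 → σ₁.PosSemidef → σ₁.trace = 1 →
      ρ₂.PosSemidef → ρ₂.trace = 1 → σ₂.PosSemidef → σ₂.trace = 1 →
      Indist (ρ₁ ⊗ₖ ρ₂) (σ₁ ⊗ₖ σ₂) ε δ) :
    IsQPP F.square (allMeasurements (b₁ × b₂)) (A₁.tensor A₂) ε δ := by
  rintro _ ⟨P, hP, rfl⟩ R T ⟨R₁, T₁, R₂, T₂, q₁, q₂, e⟩ hR hT
  obtain ⟨rfl, rfl⟩ := Prod.mk.inj e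
  rw [Framework.prob_square] at hR hT
  have nn : ∀ S, 0 ≤ P.prob F.state S := fun S => Finset.sum_nonneg fun x _ => P.nonneg x
  have hR₁ := pos_of_mul_pos_left hR (nn _)
  have hR₂ := pos_of_mul_pos_right hR (nn _)
  have hT₁ := pos_of_mul_pos_left hT (nn _)
  have hT₂ := pos_of_mul_pos_right hT (nn _)
  rw [Framework.condState_square, Framework.condState_square]
  change Indist (tensorLin A₁.toLin A₂.toLin _) (tensorLin A₁.toLin A₂.toLin _) ε δ
  rw [tensorLin_kronecker, tensorLin_kronecker]
  exact h _ _ _ _ (h₁ P hP R₁ T₁ q₁ hR₁ hT₁) (h₂ P hP R₂ T₂ q₂ hR₂ hT₂)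
    (A₁.posSemidef (P.condState_posSemidef _ _))
      ((A₁.trace_preserving _).trans (P.condState_trace _ _ hR₁))
    (A₁.posSemidef (P.condState_posSemidef _ _))
      ((A₁.trace_preserving _).trans (P.condState_trace _ _ hT₁))
    (A₂.posSemidef (P.condState_posSemidef _ _))
      ((A₂.trace_preserving _).trans (P.condState_trace _ _ hR₂))
    (A₂.posSemidef (P.condState_posSemidef _ _))
      ((A₂.trace_preserving _).trans (P.condState_trace _ _ hT₂))

end QPP

open QPP in
theorem mainTheorem5 {X a b c b₁ b₂ : Type*} [Fintype a]
    [Fintype b] [DecidableEq b] [Fintype c] [DecidableEq c]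
    [Fintype b₁] [DecidableEq b₁] [Fintype b₂] [DecidableEq b₂] (F : Framework X a) :
    -- convexity
    (∀ ε δ : ℝ, 0 ≤ ε → 0 ≤ δ → δ ≤ 1 →
      ∀ (k : ℕ) (A : Fin k → Channel a b) (p : Fin k → ℝ) (hp : p ∈ stdSimplex ℝ (Fin k)),
        (∀ i, IsQPP F (allMeasurements b) (A i) ε δ) →
          IsQPP F (allMeasurements b) (Channel.mix p hp A) ε δ) ∧
    -- post-processing
    (∀ ε δ : ℝ, 0 ≤ ε → 0 ≤ δ → δ ≤ 1 →
      ∀ (A : Channel a b) (N : Channel b c),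
        IsQPP F (allMeasurements b) A ε δ → IsQPP F (allMeasurements c) (N.comp A) ε δ) ∧
    -- parallel composability under joint measurements
    (∀ ε₁ ε₂ δ₁ δ₂ : ℝ, 0 ≤ ε₁ → 0 ≤ ε₂ → 0 ≤ δ₁ → δ₁ ≤ 1 → 0 ≤ δ₂ → δ₂ ≤ 1 →
      ∀ (A₁ : Channel a b₁) (A₂ : Channel a b₂),
        IsQPP F (allMeasurements b₁) A₁ ε₁ δ₁ → IsQPP F (allMeasurements b₂) A₂ ε₂ δ₂ →
          (δ₁ < 1 → δ₂ < 1 →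
            IsQPP F.square (allMeasurements (b₁ × b₂)) (A₁.tensor A₂)
              (ε₁ + ε₂ + Real.log (1 / ((1 - δ₁) * (1 - δ₂))))
              (√(δ₁ * (2 - δ₁)) + √(δ₂ * (2 - δ₂)))) ∧
          IsQPP F.square (allMeasurements (b₁ × b₂)) (A₁.tensor A₂)
            (ε₁ + ε₂) (min (δ₁ + Real.exp ε₁ * δ₂) (δ₂ + Real.exp ε₂ * δ₁)) ∧
          (δ₁ = 0 → δ₂ = 0 →
            IsQPP F.square (allMeasurements (b₁ × b₂)) (A₁.tensor A₂) (ε₁ + ε₂) 0)) := by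
  refine ⟨fun ε δ _ _ _ k A p hp h => isQPP_mix hp h,
    fun ε δ _ _ _ A N h => h.comp N, fun ε₁ ε₂ δ₁ δ₂ _ _ hδ₁ _ hδ₂ _ A₁ A₂ h₁ h₂ => ?_⟩
  have hmin : IsQPP F.square (allMeasurements (b₁ × b₂)) (A₁.tensor A₂)
      (ε₁ + ε₂) (min (δ₁ + Real.exp ε₁ * δ₂) (δ₂ + Real.exp ε₂ * δ₁)) := by
    refine isQPP_square_tensor h₁ h₂ fun ρ₁ σ₁ ρ₂ σ₂ d₁ d₂ hρ₁ tρ₁ hσ₁ tσ₁ hρ₂ tρ₂ hσ₂ tσ₂ => ?_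
    rcases min_choice (δ₁ + Real.exp ε₁ * δ₂) (δ₂ + Real.exp ε₂ * δ₁) with h | h <;> rw [h]
    · exact d₁.kronecker d₂ hρ₂ tρ₂.le hσ₁ tσ₁.le
    · exact d₁.kronecker' d₂ hρ₁ tρ₁.le hσ₂ tσ₂.le
  refine ⟨fun hδ₁' hδ₂' => ?_, hmin, fun h h' => by simpa [h, h'] using hmin⟩
  refine isQPP_square_tensor h₁ h₂ fun ρ₁ σ₁ ρ₂ σ₂ d₁ d₂ hρ₁ tρ₁ hσ₁ tσ₁ hρ₂ tρ₂ hσ₂ tσ₂ => ?_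
  -- The logarithmic term is nonnegative, so it only weakens the bound with exponent `ε₁ + ε₂`.
  refine (d₁.kronecker_sqrt d₂ hρ₁ tρ₁ hσ₁ tσ₁ hρ₂ tρ₂ hσ₂ hδ₁' hδ₂').mono (hσ₁.kronecker hσ₂)
    (le_add_of_nonneg_right (Real.log_nonneg ?_)) le_rfl
  rw [le_div_iff₀ (mul_pos (by linarith) (by linarith)), one_mul]
  exact mul_le_one₀ (by linarith) (by linarith) (by linarith)
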